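/- **Model.** Fix $n\in\mathbb N$ (number of credentials) and a class of admissible state spaces that contains all finite sets (for example, exactly the finite sets, or all sets). Identifiers are $0,1$; a *random tape* is an infinite sequence of bits. Credentials are *ideal*: credential $i$ has a public part (a bit string) and a secret part, which is an atomic symbol $s_i$. *Messages* are built from bit strings and the $s_i$ by pairing and by forming, for a message $m$, a *proof of availability* $\mathrm{pf}_i(m)$. From a set of known messages one can derive exactly what is obtained by writing bit strings, pairing, taking components of pairs, forming $\mathrm{pf}_i(m)$ from $s_i$ and $m$, and reading $m$ off $\mathrm{pf}_i(m)$. A *mechanism* $M$ is an automaton with an admissible state space, given by a credential generator $\mathrm{gen}_M$, which draws coins and outputs the public parts of the $n$ credentials, and a function $\mathrm{step}_M$ which, from the public parts, the time, its state, an input (a message with the identifier of its sender, or the empty input $\bot$) and coins, computes a new state, a finite list of messages to each player, and a decision in $\{\bot,0,1\}$. A *strategy* is an automaton with an admissible state space which, from the credentials available to the player, the time, its state, an input (a message from the mechanism, or $\bot$) and coins, computes a new state and a finite list of messages to the mechanism. Each invocation draws finitely many coins. Nobody can forge: every message sent must be derivable from the messages received so far and, for a player, the secret parts available to her. A *scenario*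 $\sigma=(\sigma_U,\sigma_A)\in\{0,1\}^n\times\{0,1\}^n$ says which credentials are available to the user and to the attacker. A *scheduler* $\gamma=(\gamma_{ID},\mathrm{ord},v_\gamma)$ gives the identifier $\gamma_{ID}$ to the user and $1-\gamma_{ID}$ to the attacker; in each time step its ordering function $\mathrm{ord}$, using the tape $v_\gamma$ and the record of how many messages were sent on each channel in the previous steps (but neither the messages nor the tape of the other parties), chooses for each of the three entities an ordered list of pending messages to deliver. Delays are unbounded and the order is arbitrary, but every message sent is eventually delivered. The *execution* $(M,\sigma,S_U,S_A,\gamma,v)$ generates the credentials and then proceeds in time steps $t=0,1,2,\dots$: the messages to be delivered are chosen; then player $0$, player $1$ and the mechanism, in this order, each process those delivered to them one by one, followed by $\bot$; messages sent in a step are available for delivery from the next step on. Every coin drawn by the mechanism, its generator or the players is the next bit of $v$. The execution ends as soon as the decision of $M$ is not $\bot$; the user *wins* if $M$ eventually decides $\gamma_{ID}$. $M$ is *successful* in $\sigma$ if there is a user strategy $S_U$ such that for all attacker strategies $S_A$, schedulers $\gamma$ and random tapes $v$, the user wins $(M,\sigma,S_U,S_A,\gamma,v)$. The *profile* of $M$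 is the set of scenarios in which $M$ is successful. For a set $P$ of scenarios, $M$ *solves the $P$-asynchronous authentication problem* if $P$ is contained in the profile of $M$. A mechanism $M_1$ *dominates* $M_2$ if the profile of $M_2$ is contained in the profile of $M_1$. For $f:\{0,1\}^n\to\{0,1\}$, the *Boolean mechanism* $M_f$ sends no messages, does nothing on input $\bot$, and on the first message it receives, from player $i$, decides as follows: if the message is a valid set of credentials (built by pairing from secret parts $s_j$ and the empty string) and $f(q)=1$ for the availability vector $q$ of this set, it decides $i$; otherwise it decides $1-i$. It is *monotonic* if $f$ is monotone for the coordinatewise order. **Theorem.** For every profile (set of scenarios) $P$ and every mechanism $M$, possibly interactive and randomized, that solves the $P$-asynchronous authentication problem, there is a monotone function $f:\{0,1\}^n\to\{0,1\}$ such that the monotonic Boolean mechanism $M_f$, with the credential generator of $M$, dominates $M$. -/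

import Mathlib

namespace AsyncAuth

/-! ### Random tapes -/

/-- A computation that draws finitely many random coins, one after the other, and then returns a
value. -/
inductive Coins (α : Type) : Type
  | done (a : α) : Coins α
  | toss (next : Bool → Coins α) : Coins α

/-- Running a computation on a random tape: every coin is the next bit of the tape. The value is
returned together with the unread rest of the tape. -/
def Coins.run {α : Type} : Coins α → (ℕ → Bool) → α × (ℕ → Bool)
  | .done a, v => (a, v)
  | .toss next, v => (next (v 0)).run (fun j => v (j + 1))

/-- The values that a computation can return, over all random tapes. -/
def Coins.outcomes {α : Type} (c : Coins α) : Set α :=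
  {a | ∃ v : ℕ → Bool, (c.run v).1 = a}

/-! ### Messages and ideal credentials

The secret part of the `i`-th credential is the atom `Msg.secret i`, and `Msg.proof i m` is a proof
of availability of that credential, bound to the text `m` (for example a signature of the challenge
`m`). Credentials are ideal: the secret part and the proofs cannot be produced from anything but
what `Derivable` says, however long the execution is. Public parts are strings of bits. -/

/-- Messages in a system with `n` credentials. -/
inductive Msg (n : ℕ) : Type
  | data (w : List Bool) : Msg n
  | secret (i : Fin n) : Msg n
  | proof (i : Fin n) (m : Msg n) : Msg n
  | pair (a b : Msg n) : Msg n

/-- The messages that can be produced by someone who knows the messages in `K`. -/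
inductive Derivable {n : ℕ} (K : Set (Msg n)) : Msg n → Prop
  | known {m : Msg n} (h : m ∈ K) : Derivable K m
  | data (w : List Bool) : Derivable K (Msg.data w)
  | pair {a b : Msg n} (ha : Derivable K a) (hb : Derivable K b) : Derivable K (Msg.pair a b)
  | fst {a b : Msg n} (h : Derivable K (Msg.pair a b)) : Derivable K a
  | snd {a b : Msg n} (h : Derivable K (Msg.pair a b)) : Derivable K b
  | proof {i : Fin n} {m : Msg n} (hs : Derivable K (Msg.secret i)) (hm : Derivable K m) :
      Derivable K (Msg.proof i m)
  | body {i : Fin n} {m : Msg n} (h : Derivable K (Msg.proof i m)) : Derivable K m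

/-- An availability vector: entry `i` says whether credential `i` is available to a player. -/
abbrev Availability (n : ℕ) : Type := Fin n → Bool

/-- The secret parts of the credentials available to a player. -/
def secretParts {n : ℕ} (a : Availability n) : Set (Msg n) :=
  {m | ∃ i, a i = true ∧ m = Msg.secret i}

/-- What an automaton knows after an input (`none` is the empty message). -/
def learn {n : ℕ} {In : Type} (content : In → Msg n) (K : Set (Msg n)) : Option In → Set (Msg n)
  | none => K
  | some x => insert (content x) K

/-- `Reaches K₀ init step content t s K`: the automaton can be in state `s` at time `t` when it
knows `K`, having started in state `init` with knowledge `K₀`. -/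
inductive Reaches {n : ℕ} {State In Out : Type} (K₀ : Set (Msg n)) (init : State)
    (step : ℕ → State → Option In → Coins (State × Out)) (content : In → Msg n) :
    ℕ → State → Set (Msg n) → Prop
  | start : Reaches K₀ init step content 0 init K₀
  | next {t t' : ℕ} {s s' : State} {K : Set (Msg n)} {x : Option In} {out : Out}
      (h : Reaches K₀ init step content t s K) (ht : t ≤ t')
      (hs : (s', out) ∈ (step t' s x).outcomes) :
      Reaches K₀ init step content t' s' (learn content K x)

/-- An automaton cannot forge: whatever it sends is derivable from its initial knowledge `K₀` and
the messages it received so far. -/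
def CannotForge {n : ℕ} {State In Out : Type} (K₀ : Set (Msg n)) (init : State)
    (step : ℕ → State → Option In → Coins (State × Out)) (content : In → Msg n)
    (emitted : Out → Set (Msg n)) : Prop :=
  ∀ (t : ℕ) (s : State) (K : Set (Msg n)), Reaches K₀ init step content t s K →
    ∀ t' : ℕ, t ≤ t' → ∀ (x : Option In) (s' : State) (out : Out),
      (s', out) ∈ (step t' s x).outcomes → ∀ m ∈ emitted out, Derivable (learn content K x) m

/-! ### Mechanisms and strategies -/

/-- A class of state spaces that automata may use. It contains all finite ones; `Finite` itself
(finite automata) and the class of all types (unbounded memory) are examples. -/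
structure StateClass where
  Allows : Type → Prop
  of_finite : ∀ State : Type, Finite State → Allows State

/-- What a mechanism does in one step: the messages it sends to each player, and its decision
variable (`none` as long as it has not decided). -/
structure MechOutput (n : ℕ) where
  messages : Fin 2 → List (Msg n)
  decide : Option (Fin 2)

/-- An authentication mechanism with `n` credentials. `gen` generates the public parts of the
ideal credentials. `step` gets the public parts, the time, the state, and the message with the
identifier of its sender (or `none`). -/
structure Mechanism (𝒮 : StateClass) (n : ℕ) where
  State : Type
  allowed : 𝒮.Allows State
  init : State
  gen : Coins (Fin n → List Bool)
  step : (Fin n → List Bool) → ℕ → State → Option (Msg n × Fin 2) → Coins (State × MechOutput n)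
  cannotForge : ∀ pub : Fin n → List Bool,
    CannotForge (∅ : Set (Msg n)) init (step pub) Prod.fst (fun o => {m | ∃ i, m ∈ o.messages i})

/-- A strategy of a player. `step` gets the availability vector of the player (which amounts to the
set of the secret parts available to her), the time, the state, and the message from the mechanism
(or `none`); it returns the messages sent to the mechanism. -/
structure Strategy (𝒮 : StateClass) (n : ℕ) where
  State : Type
  allowed : 𝒮.Allows State
  init : State
  step : Availability n → ℕ → State → Option (Msg n) → Coins (State × List (Msg n))
  cannotForge : ∀ a : Availability n,
    CannotForge (secretParts a) init (step a) id (fun o => {m | m ∈ o})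

/-- A scenario: the availability vectors of the user and of the attacker. -/
structure Scenario (n : ℕ) where
  user : Availability n
  attacker : Availability n

/-! ### Schedulers -/

/-- The entities that receive messages. -/
inductive Entity
  | player (i : Fin 2) : Entity
  | mech : Entity
  deriving DecidableEq

/-- The four directed channels between the players and the mechanism. -/
inductive Channel
  | toMech (i : Fin 2) : Channel
  | toPlayer (i : Fin 2) : Channel
  deriving DecidableEq

def Channel.dest : Channel → Entity
  | .toMech _ => .mech
  | .toPlayer i => .player i

/-- The player at the end of the channel that is not the mechanism. -/
def Channel.peer : Channel → Fin 2
  | .toMech i => i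
  | .toPlayer i => i

/-- `h t ch` is the number of messages sent on `ch` before time `t`; the history at time `t` lists
these numbers for the times `0, …, t`. -/
def history (h : ℕ → Channel → ℕ) (t : ℕ) : List (Channel → ℕ) :=
  (List.range (t + 1)).map h

/-- A scheduler: the identifier it gives to the user, its random tape, and its ordering function.
In each time step the latter chooses, for each entity, an ordered list of messages to be delivered
to it. The pair `(ch, k)` stands for the `k`-th message sent on the channel `ch`. The ordering
function sees when messages were sent on which channel, but not the messages, nor the random tape
of the other entities. There is no bound on delays and no constraint on the order, but every
message that is sent is delivered eventually. -/
structure Scheduler where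
  userId : Fin 2
  tape : ℕ → Bool
  ord : (ℕ → Bool) → List (Channel → ℕ) → Entity → List (Channel × ℕ)
  reliable : ∀ h : ℕ → Channel → ℕ, Monotone h → ∀ (ch : Channel) (k t : ℕ), k < h t ch →
    ∃ t', k < h t' ch ∧ (ch, k) ∈ ord tape (history h t') ch.dest

/-! ### Executions -/

/-- The state of an execution of mechanism `M` in which the player with identifier `i` uses the
strategy `S i`. `sent ch` is the list of all messages sent on `ch` so far. -/
structure Config {𝒮 : StateClass} {n : ℕ} (M : Mechanism 𝒮 n) (S : Fin 2 → Strategy 𝒮 n) where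
  time : ℕ
  tape : ℕ → Bool
  mech : M.State
  player : (i : Fin 2) → (S i).State
  sent : Channel → List (Msg n)
  delivered : Finset (Channel × ℕ)
  hist : List (Channel → ℕ)
  decision : Option (Fin 2)

section Execution

variable {𝒮 : StateClass} {n : ℕ} {M : Mechanism 𝒮 n} {S : Fin 2 → Strategy 𝒮 n}

/-- The pending messages for entity `e` among those listed in `l`, in the order of `l`. -/
def Config.chosen (c : Config M S) (e : Entity) (l : List (Channel × ℕ)) : List (Channel × ℕ) :=
  l.dedup.filter fun p => p.1.dest = e ∧ p.2 < (c.sent p.1).length ∧ p ∉ c.delivered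

/-- The messages with the identifiers of the players from whom or to whom they were sent. -/
def Config.contents (c : Config M S) (l : List (Channel × ℕ)) : List (Msg n × Fin 2) :=
  l.filterMap fun p => ((c.sent p.1)[p.2]?).map fun m => (m, p.1.peer)

/-- Player `i`, to whom the credentials in `a` are available, processes a list of inputs. -/
def Config.runPlayer (a : Availability n) (i : Fin 2) :
    List (Option (Msg n)) → Config M S → Config M S
  | [], c => c
  | x :: xs, c =>
    let r := ((S i).step a c.time (c.player i) x).run c.tape
    Config.runPlayer a i xs
      { c with
        tape := r.2
        player := Function.update c.player i r.1.1
        sent := Function.update c.sent (.toMech i) (c.sent (.toMech i) ++ r.1.2) }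

/-- The mechanism processes a list of inputs until it decides. -/
def Config.runMech (pub : Fin n → List Bool) :
    List (Option (Msg n × Fin 2)) → Config M S → Config M S
  | [], c => c
  | x :: xs, c =>
    if c.decision.isSome then c else
    let r := (M.step pub c.time c.mech x).run c.tape
    Config.runMech pub xs
      { c with
        tape := r.2
        mech := r.1.1
        sent := fun ch => match ch with
          | .toPlayer i => c.sent (.toPlayer i) ++ r.1.2.messages i
          | .toMech i => c.sent (.toMech i)
        decision := r.1.2.decide }

/-- One time step of the main loop. The messages to be delivered in this step are chosen first;
each entity processes those sent to it and then the empty message, player `0` first, then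
player `1`, then the mechanism. Nothing happens once the mechanism has decided. -/
def Config.round (γ : Scheduler) (pub : Fin n → List Bool) (C : Fin 2 → Availability n)
    (c : Config M S) : Config M S :=
  if c.decision.isSome then c else
  let hist := c.hist ++ [fun ch => (c.sent ch).length]
  let l : Entity → List (Channel × ℕ) := fun e => c.chosen e (γ.ord γ.tape hist e)
  let inputs : Fin 2 → List (Option (Msg n)) := fun i =>
    (c.contents (l (.player i))).map (fun p => some p.1) ++ [none]
  let c₀ : Config M S :=
    { c with
      hist := hist
      delivered :=
        c.delivered ∪ (l (.player 0) ++ l (.player 1) ++ l .mech).toFinset }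
  let c₁ := Config.runPlayer (C 0) 0 (inputs 0) c₀
  let c₂ := Config.runPlayer (C 1) 1 (inputs 1) c₁
  let c₃ := Config.runMech pub ((c.contents (l .mech)).map some ++ [none]) c₂
  { c₃ with time := c.time + 1 }

end Execution

/-- The strategies by identifiers: the user has the identifier that the scheduler gives to her, the
attacker has the other one. -/
def strategies {𝒮 : StateClass} {n : ℕ} (SU SA : Strategy 𝒮 n) (γ : Scheduler) :
    Fin 2 → Strategy 𝒮 n :=
  fun i => if i = γ.userId then SU else SA

/-- The availability vectors by identifiers. -/
def Scenario.byId {n : ℕ} (σ : Scenario n) (γ : Scheduler) : Fin 2 → Availability n :=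
  fun i => if i = γ.userId then σ.user else σ.attacker

/-- The execution `(M, σ, SU, SA, γ, v)` after `t` time steps: the credentials are generated with
coins from the tape `v`, and then the main loop runs. -/
def execution {𝒮 : StateClass} {n : ℕ} (M : Mechanism 𝒮 n) (σ : Scenario n)
    (SU SA : Strategy 𝒮 n) (γ : Scheduler) (v : ℕ → Bool) (t : ℕ) :
    Config M (strategies SU SA γ) :=
  (Config.round γ (M.gen.run v).1 (σ.byId γ))^[t]
    { time := 0
      tape := (M.gen.run v).2
      mech := M.init
      player := fun i => (strategies SU SA γ i).init
      sent := fun _ => []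
      delivered := ∅
      hist := []
      decision := none }

/-- The mechanism decides, at some time, that the identifier of the user belongs to the user. -/
def UserWins {𝒮 : StateClass} {n : ℕ} (M : Mechanism 𝒮 n) (σ : Scenario n)
    (SU SA : Strategy 𝒮 n) (γ : Scheduler) (v : ℕ → Bool) : Prop :=
  ∃ t, (execution M σ SU SA γ v t).decision = some γ.userId

/-! ### Success, profiles, domination -/

/-- `M` is successful in the scenario `σ`. -/
def Mechanism.Succeeds {𝒮 : StateClass} {n : ℕ} (M : Mechanism 𝒮 n) (σ : Scenario n) : Prop :=
  ∃ SU : Strategy 𝒮 n, ∀ (SA : Strategy 𝒮 n) (γ : Scheduler) (v : ℕ → Bool),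
    UserWins M σ SU SA γ v

/-- The profile of a mechanism. -/
def Mechanism.profile {𝒮 : StateClass} {n : ℕ} (M : Mechanism 𝒮 n) : Set (Scenario n) :=
  {σ | M.Succeeds σ}

/-- `M` solves the `P` asynchronous authentication problem. -/
def Mechanism.Solves {𝒮 : StateClass} {n : ℕ} (M : Mechanism 𝒮 n) (P : Set (Scenario n)) : Prop :=
  P ⊆ M.profile

/-- `M₁` dominates `M₂`. -/
def Mechanism.Dominates {𝒮 : StateClass} {n : ℕ} (M₁ M₂ : Mechanism 𝒮 n) : Prop :=
  M₂.profile ⊆ M₁.profile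

/-! ### Boolean mechanisms -/

/-- The set of credentials that a message consists of, `none` if the message is not a valid set of
credentials. A set of credentials is sent as a tuple of secret parts, ended by empty data or not. -/
def Msg.credentials {n : ℕ} : Msg n → Option (Finset (Fin n))
  | .data [] => some ∅
  | .data (_ :: _) => none
  | .secret i => some {i}
  | .proof _ _ => none
  | .pair a b =>
    match a.credentials, b.credentials with
    | some s, some t => some (s ∪ t)
    | _, _ => none

/-- Does the message present a valid set of credentials whose availability vector `f` accepts? -/
def Msg.accepted {n : ℕ} (f : Availability n → Bool) (m : Msg n) : Bool :=
  match m.credentials with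
  | some s => f (fun j => decide (j ∈ s))
  | none => false

/-- The Boolean mechanism of `f`, with credential generator `gen`: upon the first message, it
decides the identifier of the sender if `f` is true at the availability vector of the credentials
in the message, and the other identifier if `f` is false there or the message is invalid. -/
def booleanMechanism (𝒮 : StateClass) {n : ℕ} (gen : Coins (Fin n → List Bool))
    (f : Availability n → Bool) : Mechanism 𝒮 n where
  State := Unit
  allowed := 𝒮.of_finite Unit inferInstance
  init := ()
  gen := gen
  step := fun _ _ _ x =>
    match x with
    | none => .done ((), { messages := fun _ => [], decide := none })
    | some (m, i) =>
      .done ((), { messages := fun _ => [], decide := some (if m.accepted f then i else 1 - i) })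
  cannotForge := by
    intro pub t s K _ t' _ x s' out hout m hm
    rcases x with _ | ⟨m', i⟩ <;> obtain ⟨v, hv⟩ := hout <;>
      simp only [Coins.run, Prod.mk.injEq] at hv <;> obtain ⟨_, rfl⟩ := hv <;> simp at hm

end AsyncAuth

namespace AsyncAuth

/-! ### Derivable messages -/

/-! Let `f` accept the availability vectors that lie above the user's vector of some scenario in the
profile of `M`; it is the least monotone function accepting all those users. Since `f` accepts the
user of every scenario `τ` in the profile, two facts remain: `f` rejects the attacker of `τ`, and a
monotonic Boolean mechanism succeeds wherever `f` accepts the user and rejects the attacker.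

The first fact, `Mechanism.Succeeds.not_user_le_attacker`, is an indistinguishability argument.
Suppose `M` succeeds in `σ` with user strategy `A` and in `τ` with `B`, and `σ.user ≤ τ.attacker`.
Let `A` play in `σ` as player 0 against a muted `B`; the mechanism decides 0 by some time `T`. In
`τ`, let `B` be the user with identifier 1 and let the attacker, as player 0, emulate `A`, while the
scheduler withholds the messages of player 1 until time `T`. On the same tape the mechanism sees the
same run up to `T` and decides 0, so the user loses. Muting keeps the coins of `B`, because all
parties read one shared tape. Both strategies reuse the state spaces of `A` and `B`, so they are
admissible. The simulation is carried by `Config.Sim.round`.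

The second fact is `booleanMechanism_succeeds`. A Boolean mechanism sends nothing, so the attacker
knows only her own secret parts and, by monotonicity, sends only messages that `f` rejects, which
make the mechanism decide for the user. A user who presents everything she has sends only accepted
messages. So whichever message arrives first, the decision is right, and reliable delivery makes
some message arrive. -/

theorem Derivable.mono {n : ℕ} {K L : Set (Msg n)} (h : K ⊆ L) {m : Msg n}
    (hm : Derivable K m) : Derivable L m := by
  induction hm with
  | known hm => exact .known (h hm)
  | data w => exact .data w
  | pair _ _ iha ihb => exact .pair iha ihb
  | fst _ ih => exact ih.fst
  | snd _ ih => exact ih.snd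
  | proof _ _ ihs ihm => exact .proof ihs ihm
  | body _ ih => exact ih.body

theorem secretParts_mono {n : ℕ} {a b : Availability n} (h : a ≤ b) :
    secretParts a ⊆ secretParts b := by
  rintro m ⟨i, hi, rfl⟩
  exact ⟨i, Bool.eq_true_of_true_le (hi ▸ h i), rfl⟩

theorem learn_mono {n : ℕ} {In : Type} (content : In → Msg n) {K L : Set (Msg n)} (h : K ⊆ L)
    (x : Option In) : learn content K x ⊆ learn content L x := by
  cases x with
  | none => exact h
  | some x => exact Set.insert_subset_insert h

/-- Every secret part that occurs in the message belongs to a credential in `a`. -/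
def Msg.SecretsIn {n : ℕ} (a : Availability n) : Msg n → Prop
  | .data _ => True
  | .secret i => a i = true
  | .proof _ m => m.SecretsIn a
  | .pair m m' => m.SecretsIn a ∧ m'.SecretsIn a

/-- No derivation rule creates a secret part: those in a conclusion come from the known messages. A
proof of availability does not count as containing its credential, since the secret part cannot be
read off it. -/
theorem Derivable.secretsIn {n : ℕ} {a : Availability n} {m : Msg n}
    (hm : Derivable (secretParts a) m) : m.SecretsIn a := by
  induction hm with
  | known hm => obtain ⟨i, hi, rfl⟩ := hm; exact hi
  | data w => trivial
  | pair _ _ iha ihb => exact ⟨iha, ihb⟩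
  | fst _ ih => exact ih.1
  | snd _ ih => exact ih.2
  | proof _ _ _ ihm => exact ihm
  | body _ ih => exact ih

theorem Msg.SecretsIn.of_mem_credentials {n : ℕ} {a : Availability n} {m : Msg n}
    (hm : m.SecretsIn a) {s : Finset (Fin n)} (hs : m.credentials = some s) {i : Fin n}
    (hi : i ∈ s) : a i = true := by
  induction m generalizing s with
  | data w =>
    cases w with
    | nil => simp only [Msg.credentials, Option.some.injEq] at hs; subst hs; simp at hi
    | cons b w => simp [Msg.credentials] at hs
  | secret j =>
    simp only [Msg.credentials, Option.some.injEq] at hs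
    subst hs
    rw [Finset.mem_singleton] at hi
    exact hi ▸ hm
  | proof j m _ => simp [Msg.credentials] at hs
  | pair m m' ih ih' =>
    cases hc : m.credentials with
    | none => simp [Msg.credentials, hc] at hs
    | some u =>
      cases hc' : m'.credentials with
      | none => simp [Msg.credentials, hc, hc'] at hs
      | some u' =>
        simp only [Msg.credentials, hc, hc', Option.some.injEq] at hs
        subst hs
        rcases Finset.mem_union.1 hi with hi | hi
        · exact ih hm.1 hc hi
        · exact ih' hm.2 hc' hi

/-- A player to whom `f` does not grant access cannot produce a message that `f` accepts. -/
theorem Derivable.accepted_eq_false {n : ℕ} {f : Availability n → Bool} (hf : Monotone f)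
    {a : Availability n} (ha : f a = false) {m : Msg n} (hm : Derivable (secretParts a) m) :
    m.accepted f = false := by
  unfold Msg.accepted
  cases hc : m.credentials with
  | none => rfl
  | some s =>
    -- Only available credentials can be presented, so the presented vector lies below `a`, and
    -- monotonicity of `f` transfers the rejection.
    have hle : (fun j => decide (j ∈ s)) ≤ a := by
      intro j
      by_cases hj : j ∈ s
      · simp [hm.secretsIn.of_mem_credentials hc hj]
      · simp [hj]
    exact Bool.eq_false_of_le_false (ha ▸ hf hle)

/-- The tuple of the secret parts of the credentials in a list. -/
def credentialTuple {n : ℕ} : List (Fin n) → Msg n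
  | [] => .data []
  | i :: l => .pair (.secret i) (credentialTuple l)

theorem credentials_credentialTuple {n : ℕ} (l : List (Fin n)) :
    (credentialTuple l).credentials = some l.toFinset := by
  induction l with
  | nil => rfl
  | cons i l ih =>
    simp only [credentialTuple, Msg.credentials, ih, List.toFinset_cons, Finset.insert_eq]

theorem derivable_credentialTuple {n : ℕ} {a : Availability n} (l : List (Fin n))
    (hl : ∀ i ∈ l, a i = true) : Derivable (secretParts a) (credentialTuple l) := by
  induction l with
  | nil => exact .data []
  | cons i l ih =>
    rw [List.forall_mem_cons] at hl
    exact .pair (.known ⟨i, hl.1, rfl⟩) (ih hl.2)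

/-- The tuple of the secret parts of all available credentials. -/
def availableTuple {n : ℕ} (a : Availability n) : Msg n :=
  credentialTuple ((List.finRange n).filter fun i => a i)

theorem derivable_availableTuple {n : ℕ} (a : Availability n) :
    Derivable (secretParts a) (availableTuple a) :=
  derivable_credentialTuple _ fun _ hi => (List.mem_filter.1 hi).2

theorem accepted_availableTuple {n : ℕ} (f : Availability n → Bool) (a : Availability n) :
    (availableTuple a).accepted f = f a := by
  simp only [Msg.accepted, availableTuple, credentials_credentialTuple]
  congr 1
  funext j
  simp

/-! ### Executions -/

section Execution

variable {𝒮 : StateClass} {n : ℕ} {M : Mechanism 𝒮 n} {S : Fin 2 → Strategy 𝒮 n}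

theorem Config.round_of_decided {γ : Scheduler} {pub : Fin n → List Bool}
    {C : Fin 2 → Availability n} {c : Config M S} (h : c.decision.isSome) :
    c.round γ pub C = c := if_pos h

theorem execution_succ (M : Mechanism 𝒮 n) (σ : Scenario n) (SU SA : Strategy 𝒮 n)
    (γ : Scheduler) (v : ℕ → Bool) (t : ℕ) :
    execution M σ SU SA γ v (t + 1) =
      (execution M σ SU SA γ v t).round γ (M.gen.run v).1 (σ.byId γ) :=
  Function.iterate_succ_apply' _ _ _

theorem execution_eq_of_decided {σ : Scenario n} {SU SA : Strategy 𝒮 n} {γ : Scheduler}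
    {v : ℕ → Bool} {t t' : ℕ} (htt : t ≤ t')
    (h : (execution M σ SU SA γ v t).decision.isSome) :
    execution M σ SU SA γ v t' = execution M σ SU SA γ v t := by
  induction t', htt using Nat.le_induction with
  | base => rfl
  | succ t' _ ih => rw [execution_succ, ih, Config.round_of_decided h]

/-- Executions freeze once a decision is made, so the earlier decision is still there at the later
time. -/
theorem decision_unique {σ : Scenario n} {SU SA : Strategy 𝒮 n} {γ : Scheduler} {v : ℕ → Bool}
    {t t' : ℕ} {i j : Fin 2} (hi : (execution M σ SU SA γ v t).decision = some i)
    (hj : (execution M σ SU SA γ v t').decision = some j) : i = j := by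
  rcases le_total t t' with h | h
  · rw [execution_eq_of_decided h (by simp [hi]), hi] at hj
    exact Option.some.inj hj
  · rw [execution_eq_of_decided h (by simp [hj]), hj] at hi
    exact (Option.some.inj hi).symm

end Execution

/-! ### Emulating and muting strategies -/

/-- The strategy that plays `T` as if exactly the credentials in `b` were available, and remains
silent when some of these are not available. -/
def Strategy.emulate {𝒮 : StateClass} {n : ℕ} (T : Strategy 𝒮 n) (b : Availability n) :
    Strategy 𝒮 n where
  State := T.State
  allowed := T.allowed
  init := T.init
  step a t s x := if ∀ i, b i ≤ a i then T.step b t s x else .done (s, [])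
  cannotForge := by
    intro a t s K hr t' ht x s' out hout m hm
    by_cases hb : ∀ i, b i ≤ a i
    · simp only [if_pos hb] at hr hout
      -- The emulating run is a run of `T` that starts from fewer secret parts; what `T` derives
      -- from `L` is derivable from the larger `K`.
      obtain ⟨L, hL, hLr⟩ : ∃ L ⊆ K, Reaches (secretParts b) T.init (T.step b) id t s L := by
        clear hout ht
        induction hr with
        | start => exact ⟨_, secretParts_mono hb, .start⟩
        | @next t t' s s' K x out hr htt hs ih =>
          obtain ⟨L, hL, hLr⟩ := ih
          exact ⟨_, learn_mono id hL _, hLr.next htt hs⟩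
      exact (T.cannotForge b t s L hLr t' ht x s' out hout m hm).mono (learn_mono id hL x)
    · simp only [if_neg hb] at hout
      obtain ⟨v, hv⟩ := hout
      simp only [Coins.run, Prod.mk.injEq] at hv
      obtain ⟨_, rfl⟩ := hv
      simp at hm

/-- Apply a function to the value of a computation. -/
def Coins.map {α β : Type} (g : α → β) : Coins α → Coins β
  | .done a => .done (g a)
  | .toss next => .toss fun b => (next b).map g

theorem Coins.run_map {α β : Type} (g : α → β) (c : Coins α) (v : ℕ → Bool) :
    (c.map g).run v = (g (c.run v).1, (c.run v).2) := by
  induction c generalizing v with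
  | done a => rfl
  | toss next ih => exact ih _ _

/-- The strategy that draws the coins of `T` with the credentials in `b`, whatever is available,
and changes its state like `T`, but sends nothing. -/
def Strategy.mute {𝒮 : StateClass} {n : ℕ} (T : Strategy 𝒮 n) (b : Availability n) :
    Strategy 𝒮 n where
  State := T.State
  allowed := T.allowed
  init := T.init
  step _ t s x := (T.step b t s x).map fun r => (r.1, [])
  cannotForge := by
    rintro a t s K - t' - x s' out ⟨v, hv⟩ m hm
    rw [Coins.run_map, Prod.mk.injEq] at hv
    obtain ⟨_, rfl⟩ := hv
    simp at hm

/-- The unread tape is that of the unmuted step, which keeps the shared tape synchronized between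
the two executions compared later. -/
theorem Strategy.run_step_mute {𝒮 : StateClass} {n : ℕ} (T : Strategy 𝒮 n) (a b : Availability n)
    (t : ℕ) (s : T.State) (x : Option (Msg n)) (v : ℕ → Bool) :
    ((T.mute b).step a t s x).run v =
      ((((T.step b t s x).run v).1.1, []), ((T.step b t s x).run v).2) :=
  Coins.run_map _ _ _

/-! ### Delaying the messages of player `1` -/

/-- The ordering function that delivers every message at once, except that the messages of player
`1` to the mechanism are held back until time `T`. -/
def delayOrd (T : ℕ) (l : List (Channel → ℕ)) : Entity → List (Channel × ℕ)
  | .player i => (List.range ((l.getLast?.getD 0) (.toPlayer i))).map fun k => (.toPlayer i, k)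
  | .mech =>
    ((List.range ((l.getLast?.getD 0) (.toMech 0))).map fun k => (.toMech 0, k)) ++
      if T < l.length then
        (List.range ((l.getLast?.getD 0) (.toMech 1))).map fun k => (.toMech 1, k)
      else []

def delayScheduler (userId : Fin 2) (T : ℕ) : Scheduler where
  userId := userId
  tape := fun _ => false
  ord := fun _ => delayOrd T
  reliable := by
    intro h hh ch k t hk
    -- By time `max t T` the message has been sent and the hold is over: the history at that time
    -- has `max t T + 1 > T` entries.
    refine ⟨max t T, hk.trans_le (hh (le_max_left t T) ch), ?_⟩
    have hk' : k < h (max t T) ch := hk.trans_le (hh (le_max_left t T) ch)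
    have hlast : (history h (max t T)).getLast?.getD 0 = h (max t T) := by
      simp [history, List.range_succ]
    have hlen : T < (history h (max t T)).length := by
      simp [history]
    rcases ch with i | i
    · rw [Channel.dest, delayOrd, hlast, if_pos hlen]
      fin_cases i
      · simpa using hk'
      · simpa using hk'
    · rw [Channel.dest, delayOrd, hlast]
      simpa using hk'

/-! ### Executions that differ only in what player `1` sends -/

section Simulation

variable {𝒮 : StateClass} {n : ℕ} {M : Mechanism 𝒮 n} {S S' : Fin 2 → Strategy 𝒮 n}

/-- The two configurations agree, up to the translation `φ` of the states of the players, except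
for the messages of player `1` to the mechanism: there are none in the first configuration. -/
structure Config.Sim (φ : ∀ i, (S i).State → (S' i).State) (c : Config M S) (d : Config M S') :
    Prop where
  time : d.time = c.time
  tape : d.tape = c.tape
  mech : d.mech = c.mech
  player : ∀ i, d.player i = φ i (c.player i)
  sent : ∀ ch, ch ≠ .toMech 1 → d.sent ch = c.sent ch
  silent : c.sent (.toMech 1) = []
  delivered : d.delivered = c.delivered
  hist : d.hist.length = c.hist.length
  decision : d.decision = c.decision

/-- With the credentials in `C` and `C'`, the strategies in `S` and `S'` draw the same coins and go
through the same states, up to `φ`. Player `0` sends the same messages, and player `1` sends none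
according to `S 1`. -/
structure StepSim (φ : ∀ i, (S i).State → (S' i).State) (C C' : Fin 2 → Availability n) :
    Prop where
  state : ∀ i t s x v, (((S' i).step (C' i) t (φ i s) x).run v).1.1 =
    φ i (((S i).step (C i) t s x).run v).1.1
  tape : ∀ i t s x v, (((S' i).step (C' i) t (φ i s) x).run v).2 =
    (((S i).step (C i) t s x).run v).2
  out_zero : ∀ t s x v, (((S' 0).step (C' 0) t (φ 0 s) x).run v).1.2 =
    (((S 0).step (C 0) t s x).run v).1.2
  out_one : ∀ t s x v, (((S 1).step (C 1) t s x).run v).1.2 = []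

variable {φ : ∀ i, (S i).State → (S' i).State} {C C' : Fin 2 → Availability n}

/-- A player's step depends only on the time, her state, the input and the tape, all of which
correspond. The only channel on which the configurations may differ is not read. -/
theorem Config.Sim.runPlayer (H : StepSim φ C C') (i : Fin 2) (xs : List (Option (Msg n)))
    {c : Config M S} {d : Config M S'} (h : c.Sim φ d) :
    (Config.runPlayer (C i) i xs c).Sim φ (Config.runPlayer (C' i) i xs d) := by
  induction xs generalizing c d with
  | nil => exact h
  | cons x xs ih =>
    simp only [Config.runPlayer]
    refine ih
      { time := h.time, mech := h.mech, delivered := h.delivered, hist := h.hist,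
        decision := h.decision, tape := ?_, player := ?_, sent := ?_, silent := ?_ }
    · simp only [h.time, h.tape, h.player]
      exact H.tape i _ _ _ _
    · intro j
      by_cases hj : j = i
      · subst hj
        simp only [Function.update_self, h.time, h.tape, h.player]
        exact H.state j _ _ _ _
      · simp only [Function.update_of_ne hj]
        exact h.player j
    · intro ch hch
      by_cases hi : ch = .toMech i
      · subst hi
        obtain rfl : i = 0 := by
          have : i ≠ 1 := fun h1 => hch (by rw [h1])
          omega
        simp only [Function.update_self, h.time, h.tape, h.player, h.sent _ hch, H.out_zero]
      · simp only [Function.update_of_ne hi]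
        exact h.sent ch hch
    · by_cases hi : i = 1
      · subst hi
        simp only [Function.update_self, h.silent, H.out_one, List.append_nil]
      · have hne : Channel.toMech 1 ≠ Channel.toMech i := by simpa using Ne.symm hi
        simp only [Function.update_of_ne hne]
        exact h.silent

theorem Config.Sim.runMech (pub : Fin n → List Bool) (xs : List (Option (Msg n × Fin 2)))
    {c : Config M S} {d : Config M S'} (h : c.Sim φ d) :
    (Config.runMech pub xs c).Sim φ (Config.runMech pub xs d) := by
  induction xs generalizing c d with
  | nil => exact h
  | cons x xs ih =>
    simp only [Config.runMech, h.decision, h.time, h.tape, h.mech]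
    split_ifs
    · exact h
    · refine ih
        { time := rfl, delivered := h.delivered, hist := h.hist, player := h.player,
          mech := rfl, decision := rfl, tape := rfl, sent := ?_, silent := h.silent }
      rintro (i | i) hch
      · exact h.sent _ hch
      · simp only [h.sent _ hch]

theorem Config.Sim.chosen_eq {c : Config M S} {d : Config M S'} (h : c.Sim φ d) (e : Entity)
    {l : List (Channel × ℕ)} (hl : ∀ p ∈ l, p.1 ≠ .toMech 1) : d.chosen e l = c.chosen e l := by
  refine List.filter_congr fun p hp => ?_
  rw [h.sent _ (hl p (List.mem_dedup.1 hp)), h.delivered]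

theorem Config.Sim.contents_eq {c : Config M S} {d : Config M S'} (h : c.Sim φ d)
    {l : List (Channel × ℕ)} (hl : ∀ p ∈ l, p.1 ≠ .toMech 1) : d.contents l = c.contents l := by
  refine List.filterMap_congr fun p hp => ?_
  rw [h.sent _ (hl p hp)]

/-- Before time `T` the two schedulers deliver the same messages: on the left player 1 has sent
nothing, on the right what she sent is held back. All inputs then coincide, and so do the steps of
the mechanism. -/
theorem Config.Sim.round (H : StepSim φ C C') (pub : Fin n → List Bool) {T : ℕ} {i j : Fin 2}
    {c : Config M S} {d : Config M S'} (h : c.Sim φ d) (hT : c.hist.length < T) :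
    (c.round (delayScheduler i 0) pub C).Sim φ (d.round (delayScheduler j T) pub C') := by
  unfold Config.round
  by_cases hd : c.decision.isSome
  · rwa [if_pos hd, if_pos (h.decision ▸ hd)]
  rw [if_neg hd, if_neg (h.decision ▸ hd)]
  have hord : ∀ e, delayOrd T (d.hist ++ [fun ch => (d.sent ch).length]) e =
      delayOrd 0 (c.hist ++ [fun ch => (c.sent ch).length]) e := by
    -- The ordering function sees the record with the current counts appended, hence the `+ 1`; the
    -- hold is still active.
    have hT' : ¬ T < d.hist.length + 1 := by rw [h.hist]; omega
    rintro (i | _)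
    · simp [delayOrd, h.sent (.toPlayer i)]
    · simp [delayOrd, h.sent (.toMech 0), h.silent, hT']
  have hne : ∀ e, ∀ p ∈ delayOrd 0 (c.hist ++ [fun ch => (c.sent ch).length]) e,
      p.1 ≠ .toMech 1 := by
    rintro (i | _) p hp
    · simp only [delayOrd, List.mem_map] at hp
      obtain ⟨k, -, rfl⟩ := hp
      simp
    · simp only [delayOrd, List.getLast?_concat, Option.getD_some, h.silent, List.length_nil,
        List.range_zero, List.map_nil, ite_self, List.append_nil, List.mem_map] at hp
      obtain ⟨k, -, rfl⟩ := hp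
      simp
  have hchosen : ∀ e, d.chosen e (delayOrd T (d.hist ++ [fun ch => (d.sent ch).length]) e) =
      c.chosen e (delayOrd 0 (c.hist ++ [fun ch => (c.sent ch).length]) e) := fun e => by
    rw [hord, h.chosen_eq e (hne e)]
  have hmem : ∀ e, ∀ p ∈ c.chosen e (delayOrd 0 (c.hist ++ [fun ch => (c.sent ch).length]) e),
      p.1 ≠ .toMech 1 := fun e p hp =>
    hne e p (List.mem_dedup.1 (List.mem_filter.1 hp).1)
  simp only [delayScheduler, hchosen]
  rw [h.contents_eq (hmem (.player 0)), h.contents_eq (hmem (.player 1)),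
    h.contents_eq (hmem .mech)]
  have h₀ : Config.Sim φ
      { c with
        hist := c.hist ++ [fun ch => (c.sent ch).length]
        delivered := c.delivered ∪
          (c.chosen (.player 0) (delayOrd 0 (c.hist ++ [fun ch => (c.sent ch).length])
              (.player 0)) ++
            c.chosen (.player 1) (delayOrd 0 (c.hist ++ [fun ch => (c.sent ch).length])
              (.player 1)) ++
            c.chosen .mech (delayOrd 0 (c.hist ++ [fun ch => (c.sent ch).length])
              .mech)).toFinset }
      { d with
        hist := d.hist ++ [fun ch => (d.sent ch).length]
        delivered := d.delivered ∪
          (c.chosen (.player 0) (delayOrd 0 (c.hist ++ [fun ch => (c.sent ch).length])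
              (.player 0)) ++
            c.chosen (.player 1) (delayOrd 0 (c.hist ++ [fun ch => (c.sent ch).length])
              (.player 1)) ++
            c.chosen .mech (delayOrd 0 (c.hist ++ [fun ch => (c.sent ch).length])
              .mech)).toFinset } :=
    { h with
      hist := by simp [h.hist]
      delivered := by simp only [h.delivered] }
  have h₃ := ((h₀.runPlayer H 0 ((c.contents (c.chosen (.player 0) (delayOrd 0
      (c.hist ++ [fun ch => (c.sent ch).length]) (.player 0)))).map (fun p => some p.1) ++
      [none])).runPlayer H 1 ((c.contents (c.chosen (.player 1) (delayOrd 0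
      (c.hist ++ [fun ch => (c.sent ch).length]) (.player 1)))).map (fun p => some p.1) ++
      [none])).runMech pub ((c.contents (c.chosen .mech (delayOrd 0
      (c.hist ++ [fun ch => (c.sent ch).length]) .mech))).map some ++ [none])
  exact
    { time := by simp only [h.time], tape := h₃.tape, mech := h₃.mech, player := h₃.player,
      sent := h₃.sent, silent := h₃.silent, delivered := h₃.delivered, hist := h₃.hist,
      decision := h₃.decision }

end Simulation

/-! ### Frame facts: what a round leaves unchanged, growth of the channels, and the recorded history
-/

section Frame

variable {𝒮 : StateClass} {n : ℕ} {M : Mechanism 𝒮 n} {S : Fin 2 → Strategy 𝒮 n}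

@[simp] theorem Config.hist_runPlayer (a : Availability n) (i : Fin 2)
    (xs : List (Option (Msg n))) (c : Config M S) :
    (Config.runPlayer a i xs c).hist = c.hist := by
  induction xs generalizing c with
  | nil => rfl
  | cons x xs ih => rw [Config.runPlayer, ih]

@[simp] theorem Config.time_runPlayer (a : Availability n) (i : Fin 2)
    (xs : List (Option (Msg n))) (c : Config M S) :
    (Config.runPlayer a i xs c).time = c.time := by
  induction xs generalizing c with
  | nil => rfl
  | cons x xs ih => rw [Config.runPlayer, ih]

@[simp] theorem Config.delivered_runPlayer (a : Availability n) (i : Fin 2)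
    (xs : List (Option (Msg n))) (c : Config M S) :
    (Config.runPlayer a i xs c).delivered = c.delivered := by
  induction xs generalizing c with
  | nil => rfl
  | cons x xs ih => rw [Config.runPlayer, ih]

theorem Config.length_sent_le_runPlayer (a : Availability n) (i : Fin 2)
    (xs : List (Option (Msg n))) (c : Config M S) (ch : Channel) :
    (c.sent ch).length ≤ ((Config.runPlayer a i xs c).sent ch).length := by
  induction xs generalizing c with
  | nil => rfl
  | cons x xs ih =>
    rw [Config.runPlayer]
    refine le_trans ?_ (ih _)
    by_cases h : ch = .toMech i
    · subst h; simp
    · simp [Function.update_of_ne h]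

theorem Config.length_sent_le_runMech (pub : Fin n → List Bool)
    (xs : List (Option (Msg n × Fin 2))) (c : Config M S) (ch : Channel) :
    (c.sent ch).length ≤ ((Config.runMech pub xs c).sent ch).length := by
  induction xs generalizing c with
  | nil => rfl
  | cons x xs ih =>
    rw [Config.runMech]
    split_ifs
    · rfl
    · refine le_trans ?_ (ih _)
      cases ch <;> simp

theorem Config.length_sent_le_round (γ : Scheduler) (pub : Fin n → List Bool)
    (C : Fin 2 → Availability n) (c : Config M S) (ch : Channel) :
    (c.sent ch).length ≤ ((c.round γ pub C).sent ch).length := by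
  rw [Config.round]
  split_ifs
  · rfl
  · refine le_trans ?_ (Config.length_sent_le_runMech _ _ _ _)
    refine le_trans ?_ (Config.length_sent_le_runPlayer _ _ _ _ _)
    refine le_trans ?_ (Config.length_sent_le_runPlayer _ _ _ _ _)
    exact le_rfl

theorem monotone_length_sent (M : Mechanism 𝒮 n) (σ : Scenario n) (SU SA : Strategy 𝒮 n)
    (γ : Scheduler) (v : ℕ → Bool) :
    Monotone fun t ch => ((execution M σ SU SA γ v t).sent ch).length :=
  monotone_nat_of_le_succ fun t ch => by
    rw [execution_succ]
    exact Config.length_sent_le_round _ _ _ _ _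

theorem Config.runMech_of_decided {pub : Fin n → List Bool}
    {xs : List (Option (Msg n × Fin 2))} {c : Config M S} (h : c.decision.isSome) :
    Config.runMech pub xs c = c := by
  cases xs with
  | nil => rfl
  | cons x xs => exact if_pos h

@[simp] theorem Config.time_runMech (pub : Fin n → List Bool)
    (xs : List (Option (Msg n × Fin 2))) (c : Config M S) :
    (Config.runMech pub xs c).time = c.time := by
  induction xs generalizing c with
  | nil => rfl
  | cons x xs ih =>
    rw [Config.runMech]
    split_ifs
    · rfl
    · rw [ih]

@[simp] theorem Config.delivered_runMech (pub : Fin n → List Bool)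
    (xs : List (Option (Msg n × Fin 2))) (c : Config M S) :
    (Config.runMech pub xs c).delivered = c.delivered := by
  induction xs generalizing c with
  | nil => rfl
  | cons x xs ih =>
    rw [Config.runMech]
    split_ifs
    · rfl
    · rw [ih]

@[simp] theorem Config.hist_runMech (pub : Fin n → List Bool)
    (xs : List (Option (Msg n × Fin 2))) (c : Config M S) :
    (Config.runMech pub xs c).hist = c.hist := by
  induction xs generalizing c with
  | nil => rfl
  | cons x xs ih =>
    rw [Config.runMech]
    split_ifs
    · rfl
    · rw [ih]

theorem Config.hist_round {γ : Scheduler} {pub : Fin n → List Bool} {C : Fin 2 → Availability n}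
    {c : Config M S} (h : ¬ c.decision.isSome) :
    (c.round γ pub C).hist = c.hist ++ [fun ch => (c.sent ch).length] := by
  rw [Config.round, if_neg h]
  simp

/-- Frozen rounds record nothing, so a run without decision is needed. There the record with the
current counts appended is a `history`, the form in which `reliable` applies. -/
theorem hist_execution {σ : Scenario n} {SU SA : Strategy 𝒮 n} {γ : Scheduler} {v : ℕ → Bool}
    (h : ∀ t, (execution M σ SU SA γ v t).decision = none) (t : ℕ) :
    (execution M σ SU SA γ v t).hist =
      (List.range t).map fun t ch => ((execution M σ SU SA γ v t).sent ch).length := by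
  induction t with
  | zero => rfl
  | succ t ih =>
    rw [execution_succ, Config.hist_round (by simp [h]), ih, List.range_succ]
    simp

theorem length_hist_execution_le (M : Mechanism 𝒮 n) (σ : Scenario n) (SU SA : Strategy 𝒮 n)
    (γ : Scheduler) (v : ℕ → Bool) (t : ℕ) :
    (execution M σ SU SA γ v t).hist.length ≤ t := by
  induction t with
  | zero => simp [execution]
  | succ t ih =>
    rw [execution_succ]
    by_cases h : (execution M σ SU SA γ v t).decision.isSome
    · rw [Config.round_of_decided h]; omega
    · rw [Config.hist_round h]; simpa using ih

end Frame

/-- In scenarios in which a mechanism is successful, an attacker never has all the credentials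
that suffice for a user. -/
theorem Mechanism.Succeeds.not_user_le_attacker {𝒮 : StateClass} {n : ℕ} {M : Mechanism 𝒮 n}
    {σ τ : Scenario n} (hσ : M.Succeeds σ) (hτ : M.Succeeds τ) : ¬ σ.user ≤ τ.attacker := by
  intro hle
  obtain ⟨A, hA⟩ := hσ
  obtain ⟨B, hB⟩ := hτ
  let v : ℕ → Bool := fun _ => false
  -- The deadline `T` comes from the first execution, in which player 1 is silent; the second
  -- scheduler is then built from it.
  obtain ⟨T, hT⟩ := hA (B.mute τ.user) (delayScheduler 0 0) v
  obtain ⟨T', hT'⟩ := hB (A.emulate σ.user) (delayScheduler 1 T) v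
  -- The state spaces agree for each identifier, so the translation is the identity; the case split
  -- only lets the types reduce.
  let φ : ∀ i, (strategies A (B.mute τ.user) (delayScheduler 0 0) i).State →
      (strategies B (A.emulate σ.user) (delayScheduler 1 T) i).State := fun i =>
    match i with
    | 0 => fun s => s
    | 1 => fun s => s
  have hstep₀ : ∀ t s x, (A.emulate σ.user).step τ.attacker t s x = A.step σ.user t s x :=
    fun t s x => if_pos hle
  have H : StepSim φ (σ.byId (delayScheduler 0 0)) (τ.byId (delayScheduler 1 T)) :=
    { state := fun i t s x v => by
        match i with
        | 0 => exact congrArg (fun r => (r.run v).1.1) (hstep₀ t s x)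
        | 1 => exact congrArg (fun r => r.1.1) (B.run_step_mute σ.attacker τ.user t s x v).symm
      tape := fun i t s x v => by
        match i with
        | 0 => exact congrArg (fun r => (r.run v).2) (hstep₀ t s x)
        | 1 => exact congrArg (fun r => r.2) (B.run_step_mute σ.attacker τ.user t s x v).symm
      out_zero := fun t s x v => congrArg (fun r => (r.run v).1.2) (hstep₀ t s x)
      out_one := fun t s x v =>
        congrArg (fun r => r.1.2) (B.run_step_mute σ.attacker τ.user t s x v) }
  have hsim : ∀ t ≤ T,
      (execution M σ A (B.mute τ.user) (delayScheduler 0 0) v t).Sim φ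
        (execution M τ B (A.emulate σ.user) (delayScheduler 1 T) v t) := by
    intro t
    induction t with
    | zero =>
      intro _
      exact
        { time := rfl, tape := rfl, mech := rfl, sent := fun _ _ => rfl, silent := rfl,
          delivered := rfl, hist := rfl, decision := rfl
          player := fun i => by
            match i with
            | 0 => rfl
            | 1 => rfl }
    | succ t ih =>
      intro ht
      rw [execution_succ, execution_succ]
      exact (ih (by omega)).round H _ ((length_hist_execution_le _ _ _ _ _ _ t).trans_lt ht)
  have hT₂ := (hsim T le_rfl).decision.trans hT
  -- In the second execution the mechanism has decided 0 by simulation and 1 because `B` wins.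
  exact absurd (decision_unique hT₂ hT') (by simp [delayScheduler])

/-! ### Boolean mechanisms -/

section Boolean

variable {𝒮 : StateClass} {n : ℕ} {gen : Coins (Fin n → List Bool)} {f : Availability n → Bool}
  {S : Fin 2 → Strategy 𝒮 n} {C : Fin 2 → Availability n} {good : Fin 2 → Msg n → Prop}
  {userId : Fin 2}

/-- In an execution of a Boolean mechanism: the players have received no messages, the messages of
player `i` satisfy `good i`, and no wrong decision has been made. -/
structure Config.Sound (C : Fin 2 → Availability n) (good : Fin 2 → Msg n → Prop)
    (userId : Fin 2) (c : Config (booleanMechanism 𝒮 gen f) S) : Prop where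
  toPlayer : ∀ i, c.sent (.toPlayer i) = []
  toMech : ∀ i, ∀ m ∈ c.sent (.toMech i), good i m
  reaches : ∀ i, ∃ t ≤ c.time, Reaches (secretParts (C i)) (S i).init ((S i).step (C i)) id t
    (c.player i) (secretParts (C i))
  decision : ∀ j ∈ c.decision, j = userId

/-- Without any messages from the mechanism, player `i` sends only messages that satisfy
`good i`. -/
def SendsGood (S : Fin 2 → Strategy 𝒮 n) (C : Fin 2 → Availability n)
    (good : Fin 2 → Msg n → Prop) : Prop :=
  ∀ i t s, Reaches (secretParts (C i)) (S i).init ((S i).step (C i)) id t s (secretParts (C i)) →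
    ∀ t', t ≤ t' → ∀ s' out, (s', out) ∈ ((S i).step (C i) t' s none).outcomes →
      ∀ m ∈ out, good i m

/-- The only input is the empty message, so the player's knowledge stays at her own secret parts and
`SendsGood` keeps applying. -/
theorem Config.Sound.runPlayer (hS : SendsGood S C good)
    {c : Config (booleanMechanism 𝒮 gen f) S} (h : c.Sound C good userId) (i : Fin 2) :
    (Config.runPlayer (C i) i [none] c).Sound C good userId := by
  obtain ⟨t, ht, hr⟩ := h.reaches i
  have hout : (((S i).step (C i) c.time (c.player i) none).run c.tape).1 ∈
      ((S i).step (C i) c.time (c.player i) none).outcomes := ⟨_, rfl⟩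
  refine ⟨fun j => ?_, fun j => ?_, fun j => ?_, h.decision⟩
  · simpa [Config.runPlayer] using h.toPlayer j
  · by_cases hj : j = i
    · subst hj
      simp only [Config.runPlayer, Function.update_self, List.mem_append]
      rintro m (hm | hm)
      · exact h.toMech j m hm
      · exact hS j t _ hr _ ht _ _ hout m hm
    · have hne : Channel.toMech j ≠ Channel.toMech i := by simpa using hj
      simp only [Config.runPlayer, Function.update_of_ne hne]
      exact h.toMech j
  · by_cases hj : j = i
    · subst hj
      simp only [Config.runPlayer, Function.update_self]
      exact ⟨_, le_rfl, hr.next (x := none) ht hout⟩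
    · simp only [Config.runPlayer, Function.update_of_ne hj]
      exact h.reaches j

theorem Config.Sound.runMech
    (hgood : ∀ i m, good i m → (if m.accepted f then i else 1 - i) = userId)
    {pub : Fin n → List Bool} {xs : List (Option (Msg n × Fin 2))}
    (hxs : ∀ p, some p ∈ xs → good p.2 p.1)
    {c : Config (booleanMechanism 𝒮 gen f) S} (h : c.Sound C good userId) :
    (Config.runMech pub xs c).Sound C good userId := by
  induction xs generalizing c with
  | nil => exact h
  | cons x xs ih =>
    rw [Config.runMech]
    split_ifs
    · exact h
    · refine ih (fun p hp => hxs p (List.mem_cons_of_mem _ hp)) ⟨fun i => ?_, h.toMech, h.reaches, ?_⟩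
      · rcases x with _ | ⟨m, j⟩ <;> simp [booleanMechanism, Coins.run, h.toPlayer]
      · rcases x with _ | ⟨m, j⟩
        · simp [booleanMechanism, Coins.run]
        · rintro _ ⟨⟩
          exact hgood j m (hxs (m, j) List.mem_cons_self)

theorem Config.isSome_decision_runMech {pub : Fin n → List Bool} {p : Msg n × Fin 2}
    {xs : List (Option (Msg n × Fin 2))} (c : Config (booleanMechanism 𝒮 gen f) S) :
    (Config.runMech pub (some p :: xs) c).decision.isSome := by
  rw [Config.runMech]
  split_ifs with h
  · exact h
  · rw [Config.runMech_of_decided] <;> rfl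

theorem Config.contents_ne_nil {M : Mechanism 𝒮 n} {c : Config M S} {e : Entity}
    {l : List (Channel × ℕ)} (h : c.chosen e l ≠ []) : c.contents (c.chosen e l) ≠ [] := by
  obtain ⟨p, hp⟩ := List.exists_mem_of_ne_nil _ h
  have hlt : p.2 < (c.sent p.1).length := by
    have := (List.mem_filter.1 hp).2
    simp only [decide_eq_true_eq] at this
    exact this.2.1
  refine List.ne_nil_of_mem (a := ((c.sent p.1)[p.2], p.1.peer))
    (List.mem_filterMap.2 ⟨p, hp, ?_⟩)
  simp [hlt]

theorem Config.Sound.chosen_player {c : Config (booleanMechanism 𝒮 gen f) S}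
    (h : c.Sound C good userId) (i : Fin 2) (l : List (Channel × ℕ)) :
    c.chosen (.player i) l = [] := by
  refine List.filter_eq_nil_iff.2 ?_
  rintro ⟨j | j, k⟩ -
  · simp [Channel.dest]
  · simp [h.toPlayer]

theorem Config.Sound.good_of_mem_contents {c : Config (booleanMechanism 𝒮 gen f) S}
    (h : c.Sound C good userId) {l : List (Channel × ℕ)} {p : Msg n × Fin 2}
    (hp : p ∈ c.contents l) : good p.2 p.1 := by
  obtain ⟨⟨ch, k⟩, -, hq⟩ := List.mem_filterMap.1 hp
  obtain ⟨m, hm, rfl⟩ := Option.map_eq_some_iff.1 hq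
  rcases ch with j | j
  · exact h.toMech j m (List.mem_of_getElem? hm)
  · simp [h.toPlayer] at hm

theorem Config.Sound.round (hS : SendsGood S C good)
    (hgood : ∀ i m, good i m → (if m.accepted f then i else 1 - i) = userId)
    {γ : Scheduler} {pub : Fin n → List Bool} {c : Config (booleanMechanism 𝒮 gen f) S}
    (h : c.Sound C good userId) : (c.round γ pub C).Sound C good userId := by
  rw [Config.round]
  split_ifs
  · exact h
  simp only [h.chosen_player]
  have h₀ : Config.Sound C good userId
      { c with
        hist := c.hist ++ [fun ch => (c.sent ch).length]
        delivered := c.delivered ∪ ([] ++ [] ++ c.chosen .mech (γ.ord γ.tape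
          (c.hist ++ [fun ch => (c.sent ch).length]) .mech)).toFinset } :=
    ⟨h.toPlayer, h.toMech, h.reaches, h.decision⟩
  have h₃ := ((h₀.runPlayer hS 0).runPlayer hS 1).runMech hgood (pub := pub)
    (xs := (c.contents (c.chosen .mech (γ.ord γ.tape
      (c.hist ++ [fun ch => (c.sent ch).length]) .mech))).map some ++ [none])
    (fun p hp => h.good_of_mem_contents (by simpa using hp))
  refine ⟨h₃.toPlayer, h₃.toMech, fun i => ?_, h₃.decision⟩
  obtain ⟨t, ht, hr⟩ := h₃.reaches i
  simp only [Config.time_runMech, Config.time_runPlayer] at ht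
  exact ⟨t, ht.trans (Nat.le_succ _), hr⟩

theorem Config.isSome_decision_round {γ : Scheduler} {pub : Fin n → List Bool}
    {c : Config (booleanMechanism 𝒮 gen f) S}
    (h : c.chosen .mech (γ.ord γ.tape (c.hist ++ [fun ch => (c.sent ch).length]) .mech) ≠ []) :
    (c.round γ pub C).decision.isSome := by
  rw [Config.round]
  split_ifs with hd
  · exact hd
  · obtain ⟨p, l, hl⟩ := List.exists_cons_of_ne_nil (Config.contents_ne_nil h)
    simp only [hl, List.map_cons, List.cons_append]
    exact Config.isSome_decision_runMech _

/-- Any delivery to the mechanism forces a decision, so a round that ends undecided has delivered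
nothing. -/
theorem Config.Sound.notMem_delivered_round {γ : Scheduler} {pub : Fin n → List Bool}
    {c : Config (booleanMechanism 𝒮 gen f) S} (h : c.Sound C good userId)
    (hd : (c.round γ pub C).decision = none) {i : Fin 2} {k : ℕ}
    (hk : (.toMech i, k) ∉ c.delivered) : (.toMech i, k) ∉ (c.round γ pub C).delivered := by
  have hnil : c.chosen .mech (γ.ord γ.tape (c.hist ++ [fun ch => (c.sent ch).length]) .mech) =
      [] := by
    by_contra hne
    simpa [hd] using Config.isSome_decision_round (pub := pub) (C := C) hne
  rw [Config.round]
  split_ifs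
  · exact hk
  · simpa [h.chosen_player, hnil] using hk

theorem Config.length_sent_runPlayer_pos {M : Mechanism 𝒮 n} {a : Availability n} {i : Fin 2}
    (hi : ∀ t s x v, (((S i).step a t s x).run v).1.2 ≠ []) {xs : List (Option (Msg n))}
    (hxs : xs ≠ []) (c : Config M S) :
    0 < ((Config.runPlayer a i xs c).sent (.toMech i)).length := by
  obtain ⟨x, xs, rfl⟩ := List.exists_cons_of_ne_nil hxs
  rw [Config.runPlayer]
  refine lt_of_lt_of_le ?_ (Config.length_sent_le_runPlayer _ _ _ _ _)
  simp only [Function.update_self, List.length_append]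
  exact Nat.add_pos_right _ (List.length_pos_iff.2 (hi _ _ _ _))

theorem Config.length_sent_round_pos {M : Mechanism 𝒮 n} {i : Fin 2}
    (hi : ∀ t s x v, (((S i).step (C i) t s x).run v).1.2 ≠ []) {γ : Scheduler}
    {pub : Fin n → List Bool} {c : Config M S} (hd : c.decision = none) :
    0 < ((c.round γ pub C).sent (.toMech i)).length := by
  rw [Config.round, if_neg (by simp [hd])]
  refine lt_of_lt_of_le ?_ (Config.length_sent_le_runMech _ _ _ _)
  match i with
  | 0 =>
    refine lt_of_lt_of_le ?_ (Config.length_sent_le_runPlayer _ _ _ _ _)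
    exact Config.length_sent_runPlayer_pos hi (by simp) _
  | 1 => exact Config.length_sent_runPlayer_pos hi (by simp) _

/-- Soundness excludes a wrong decision, so a lost execution would never decide. The user's first
message would then stay undelivered forever, against the reliability of the scheduler. -/
theorem userWins_booleanMechanism {σ : Scenario n} {SU SA : Strategy 𝒮 n} {γ : Scheduler}
    (v : ℕ → Bool)
    (hgood : ∀ i m, good i m → (if m.accepted f then i else 1 - i) = γ.userId)
    (hS : SendsGood (strategies SU SA γ) (σ.byId γ) good)
    (hU : ∀ t s x v, (((strategies SU SA γ γ.userId).step (σ.byId γ γ.userId) t s x).run v).1.2 ≠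
      []) :
    UserWins (booleanMechanism 𝒮 gen f) σ SU SA γ v := by
  set e := execution (booleanMechanism 𝒮 gen f) σ SU SA γ v with he
  have hsucc : ∀ t, e (t + 1) = (e t).round γ (gen.run v).1 (σ.byId γ) :=
    execution_succ (booleanMechanism 𝒮 gen f) σ SU SA γ v
  have hsound : ∀ t, (e t).Sound (σ.byId γ) good γ.userId := by
    intro t
    induction t with
    | zero => exact ⟨fun _ => rfl, by simp [he, execution], fun i => ⟨0, le_rfl, .start⟩,
        by simp [he, execution]⟩
    | succ t ih => rw [hsucc]; exact ih.round hS hgood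
  by_contra hwin
  have hnone : ∀ t, (e t).decision = none := by
    intro t
    by_contra hne
    obtain ⟨j, hj⟩ := Option.ne_none_iff_exists'.1 hne
    exact hwin ⟨t, by rw [← he, hj, (hsound t).decision j hj]⟩
  have hdel : ∀ t i k, (Channel.toMech i, k) ∉ (e t).delivered := by
    intro t i k
    induction t with
    | zero => simp [he, execution]
    | succ t ih =>
      have hd := hnone (t + 1)
      rw [hsucc] at hd ⊢
      exact (hsound t).notMem_delivered_round hd ih
  have hpos : 0 < ((e 1).sent (.toMech γ.userId)).length := by
    rw [hsucc]
    exact Config.length_sent_round_pos hU (hnone 0)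
  -- The user sends in every step, so her message number 0 exists at time 1 and must be scheduled at
  -- some time `t`.
  obtain ⟨t, hlt, hmem⟩ := γ.reliable _
    (monotone_length_sent (booleanMechanism 𝒮 gen f) σ SU SA γ v) _ _ 1 hpos
  have hhist : (e t).hist ++ [fun ch => ((e t).sent ch).length] =
      history (fun t ch => ((e t).sent ch).length) t := by
    rw [hist_execution hnone, history, List.range_succ]
    simp [he]
  have hsome : (e (t + 1)).decision.isSome := by
    rw [hsucc]
    refine Config.isSome_decision_round (List.ne_nil_of_mem (a := (.toMech γ.userId, 0)) ?_)
    rw [hhist]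
    refine List.mem_filter.2 ⟨List.mem_dedup.2 hmem, ?_⟩
    simp only [decide_eq_true_eq]
    exact ⟨rfl, hlt, hdel t _ _⟩
  simp [hnone] at hsome

/-- The strategy that presents all available credentials, whatever the input. -/
def presentAll (𝒮 : StateClass) (n : ℕ) : Strategy 𝒮 n where
  State := Unit
  allowed := 𝒮.of_finite Unit inferInstance
  init := ()
  step a _ _ _ := .done ((), [availableTuple a])
  cannotForge := by
    rintro a t s K hr t' - x s' out ⟨v, hv⟩ m hm
    simp only [Coins.run, Prod.mk.injEq] at hv
    obtain ⟨_, rfl⟩ := hv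
    obtain rfl := List.mem_singleton.1 hm
    refine (derivable_availableTuple a).mono ?_
    -- Knowledge only grows along a run, so the initial secret parts remain available.
    have hK : secretParts a ⊆ K := by
      clear hm
      induction hr with
      | start => rfl
      | @next _ _ _ _ _ x _ _ _ _ ih =>
        cases x with
        | none => exact ih
        | some x => exact ih.trans (Set.subset_insert _ _)
    cases x with
    | none => exact hK
    | some x => exact hK.trans (Set.subset_insert _ _)

/-- A monotonic Boolean mechanism is successful if it accepts the credentials of the user and
rejects those of the attacker. -/
theorem booleanMechanism_succeeds (hf : Monotone f) {σ : Scenario n} (hU : f σ.user = true)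
    (hA : f σ.attacker = false) : (booleanMechanism 𝒮 gen f).Succeeds σ := by
  -- With this `good`, `f` accepts exactly the user's messages: hers yield her own identifier, the
  -- attacker's yield the opposite one, which is again the user's.
  refine ⟨presentAll 𝒮 n, fun SA γ v => userWins_booleanMechanism
    (good := fun i m => m.accepted f = decide (i = γ.userId)) v ?_ ?_ ?_⟩
  · intro i m hm
    simp only [hm, decide_eq_true_eq]
    split_ifs with hi <;> omega
  · intro i
    by_cases hi : i = γ.userId
    · have hs : strategies (presentAll 𝒮 n) SA γ i = presentAll 𝒮 n := if_pos hi
      have hc : σ.byId γ i = σ.user := if_pos hi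
      rw [hs, hc]
      rintro t s - t' - s' out ⟨v, hv⟩ m hm
      simp only [presentAll, Coins.run] at hv
      obtain ⟨_, rfl⟩ := hv
      obtain rfl := List.mem_singleton.1 hm
      simp [accepted_availableTuple, hU, hi]
    · have hs : strategies (presentAll 𝒮 n) SA γ i = SA := if_neg hi
      have hc : σ.byId γ i = σ.attacker := if_neg hi
      rw [hs, hc]
      intro t s hr t' ht s' out hout m hm
      simpa [hi] using
        (SA.cannotForge σ.attacker t s _ hr t' ht none s' out hout m hm).accepted_eq_false hf hA
  · have hs : strategies (presentAll 𝒮 n) SA γ γ.userId = presentAll 𝒮 n := if_pos rfl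
    rw [hs]
    intro t s x v
    simp [presentAll, Coins.run]

end Boolean

end AsyncAuth

theorem mainTheorem1 (𝒮 : AsyncAuth.StateClass) (n : ℕ)
    (P : Set (AsyncAuth.Scenario n)) (M : AsyncAuth.Mechanism 𝒮 n) (hM : M.Solves P) :
    ∃ f : AsyncAuth.Availability n → Bool, Monotone f ∧
      (AsyncAuth.booleanMechanism 𝒮 M.gen f).Dominates M := by
  classical
  -- The upward closure of the users' vectors in the profile.
  have hf : Monotone fun q : AsyncAuth.Availability n => decide (∃ σ ∈ M.profile, σ.user ≤ q) := by
    intro p q hpq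
    refine Bool.le_iff_imp.2 fun hp => ?_
    obtain ⟨σ, hσ, hle⟩ := of_decide_eq_true hp
    exact decide_eq_true ⟨σ, hσ, hle.trans hpq⟩
  refine ⟨_, hf, fun τ hτ => ?_⟩
  refine AsyncAuth.booleanMechanism_succeeds hf (decide_eq_true ⟨τ, hτ, le_rfl⟩)
    (decide_eq_false ?_)
  rintro ⟨σ, hσ, hle⟩
  exact AsyncAuth.Mechanism.Succeeds.not_user_le_attacker hσ hτ hle
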